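/- Let $p\ge 3$ be a prime number, let $\mathbf{C}_p$ be the completed algebraic closure of $\mathbf{Q}_p$ with valuation $v_p$ normalized by $v_p(p)=1$, let $\mathcal{O}_{\mathbf{C}_p}^\flat=\varprojlim_{x\mapsto x^p}\mathcal{O}_{\mathbf{C}_p}/p$ be its tilted ring of integers, and let $v^\flat$ be the valuation $v^\flat(x)=v_p(x^\sharp)$ on it. Let $\pi$ be a uniformizer of $\mathbf{Z}_p$, let $u=(\pi,\pi^{1/p},\pi^{1/p^2},\dots)$ and $\eta=\varepsilon-1$ with $\varepsilon=(1,\zeta_p,\zeta_{p^2},\dots)$ be the elements of $\mathcal{O}_{\mathbf{C}_p}^\flat$ attached to compatible systems of $p$-power roots of $\pi$ and of primitive $p^n$-th roots of unity. Let $\mathbf{E}^{\mathrm{np},\circ,+}_{\mathfrak F,\mathbf{Q}_p}$ be the image of the map $$\mathbf{F}_p[[X,Y]]\to\mathcal{O}_{\mathbf{C}_p}^\flat,\qquad \sum_{i,j}f_{ij}X^iY^j\mapsto \sum_{i,j} f_{ij}u^i\eta^j:=\lim_{n\to\infty}\sum_{i=0}^n\sum_{j=0}^n f_{ij}u^i\eta^j,$$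 and for a nonzero series put $$v_{\mathrm{mono}}\Big(\sum_{i,j}f_{ij}u^i\eta^j\Big)=\min_{f_{ij}\neq0}\big(i\,v^\flat(u)+j\,v^\flat(\eta)\big).$$ For real $t\ge 0$ put $$\mathfrak{M}(t)=\frac{p^{2\lceil t\rceil+3}}{p-1}\prod_{k=0}^{\lceil t\rceil}\Big(k+\frac{p+1}{p}\Big)^2-(p-1)\sum_{k=0}^{\lceil t\rceil}(k+1)p^k\prod_{l=0}^{k-1}\Big(l+\frac{p+1}{p}\Big).$$ Then $\mathfrak{M}$ takes positive rational values, and there is a constant $A>0$ depending only on $p$ such that $$\mathfrak{M}(t)\le A\,p^{2t}\,\Gamma\Big(t+3+\frac1p\Big)^2\qquad\text{for all real } t\ge0 .$$ Moreover, for every $f=\sum_{i,j}f_{ij}u^i\eta^j\in\mathbf{E}^{\mathrm{np},\circ,+}_{\mathfrak F,\mathbf{Q}_p}$ given by a nonzero power series $\sum_{i,j} f_{ij}X^iY^j\in\mathbf{F}_p[[X,Y]]$ and satisfying $v^\flat(f)\ge\mathfrak{M}(0)$, one has $$v_{\mathrm{mono}}(f)\le v^\flat(f)<\mathfrak{M}\big(v_{\mathrm{mono}}(f)\big).$$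 In particular $\mathfrak{M}(v_{\mathrm{mono}}(f))=O\big(p^{2v_{\mathrm{mono}}(f)}\,\Gamma(v_{\mathrm{mono}}(f)+3+\tfrac1p)^2\big)$. -/

import Mathlib

open scoped NNReal

noncomputable section

namespace FalseTate

variable (p : ℕ) [Fact p.Prime]

/-- `p` is not invertible in the ring of integers of `ℂ_p`. -/
instance notIsUnit_p : Fact (¬ IsUnit (p : 𝓞_ℂ_[p])) := ⟨fun h => by
  have h1 := (PadicComplexInt.integers p).isUnit_iff_valuation_eq_one.1 h
  have h2 : (PadicComplex.valued p).v (p : ℂ_[p]) = 1 := by simpa using h1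
  rw [PadicComplex.valuation_p] at h2
  have h3 : (1 : ℝ≥0) < p := by exact_mod_cast (Fact.out : p.Prime).one_lt
  rw [div_eq_one_iff_eq (by positivity)] at h2
  exact h3.ne h2⟩

/-- The ring `O_{ℂ_p}^♭ = lim_{x ↦ x ^ p} O_{ℂ_p} / p`. -/
abbrev OCpFlat : Type := PreTilt 𝓞_ℂ_[p] p

variable {p}

/-- The multiplicative valuation on `O_{ℂ_p}^♭`, normalised by `|p| = 1 / p` on `ℂ_p`:
if the `n`-th component of `x` is the class of `a ∉ p O_{ℂ_p}`, it sends `x` to `|a| ^ (p ^ n)`. -/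
def absFlat : Valuation (OCpFlat p) ℝ≥0 :=
  PreTilt.val ℂ_[p] (PadicComplex.valued p).v 𝓞_ℂ_[p] (PadicComplexInt.integers p) p

/-- The perfectoid valuation `v^♭` on `O_{ℂ_p}^♭`, written additively: `v^♭(x) = v_p(x^♯)` with
`v_p(p) = 1`, and `v^♭(0) = ∞`. -/
def vFlat (x : OCpFlat p) : EReal :=
  open Classical in if x = 0 then ⊤ else ((-Real.logb p (absFlat x : ℝ) : ℝ) : EReal)

/-- The element `(a 0, a 1, a 2, …)` of `O_{ℂ_p}^♭` given by a compatible system of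
`p`-power roots in `O_{ℂ_p}`. -/
def ofRoots (a : ℕ → 𝓞_ℂ_[p]) (ha : ∀ n, a (n + 1) ^ p = a n) : OCpFlat p :=
  ⟨fun n => Ideal.Quotient.mk _ (a n), fun n => by
    change (Ideal.Quotient.mk _ (a (n + 1))) ^ p = _
    rw [← map_pow, ha]⟩

/-- The coefficient `f_{ij}` of `X ^ i Y ^ j` in `f ∈ 𝔽_p[[X, Y]]`. -/
def coeffXY (F : MvPowerSeries (Fin 2) (ZMod p)) (i j : ℕ) : ZMod p :=
  MvPowerSeries.coeff (Finsupp.single 0 i + Finsupp.single 1 j) F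

/-- The partial sum `∑_{i ≤ n} ∑_{j ≤ n} f_{ij} α ^ i β ^ j`. -/
def partialSum (α β : OCpFlat p) (F : MvPowerSeries (Fin 2) (ZMod p)) (n : ℕ) : OCpFlat p :=
  ∑ i ∈ Finset.range (n + 1), ∑ j ∈ Finset.range (n + 1),
    ZMod.castHom (dvd_refl p) (OCpFlat p) (coeffXY F i j) * α ^ i * β ^ j

/-- `y` is the limit of the partial sums of `f(α, β)` for the valuation `v^♭`. -/
def IsValueAt (α β : OCpFlat p) (F : MvPowerSeries (Fin 2) (ZMod p)) (y : OCpFlat p) : Prop :=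
  ∀ c : ℝ, ∀ᶠ n in Filter.atTop, (c : EReal) ≤ vFlat (partialSum α β F n - y)

/-- `f(α, β) = lim_n ∑_{i ≤ n} ∑_{j ≤ n} f_{ij} α ^ i β ^ j`. The limit exists and is unique for
the `α`, `β` that are used, see `isValueAt_evalXY` and `IsValueAt.unique`. -/
def evalXY (α β : OCpFlat p) (F : MvPowerSeries (Fin 2) (ZMod p)) : OCpFlat p :=
  open Classical in if h : ∃ y, IsValueAt α β F y then h.choose else 0

/-- The monomial valuation
`v_mono(∑ f_{ij} α ^ i β ^ j) = min {i v^♭(α) + j v^♭(β) | f_{ij} ≠ 0}`, equal to `∞` for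
the zero series. -/
def vMono (α β : OCpFlat p) (F : MvPowerSeries (Fin 2) (ZMod p)) : EReal :=
  ⨅ (i : ℕ) (j : ℕ) (_ : coeffXY F i j ≠ 0), (i : EReal) * vFlat α + (j : EReal) * vFlat β

/-- The function `𝔐(t)`, for real `t ≥ 0`; its values are rational. -/
def frakM (p : ℕ) (t : ℝ) : ℚ :=
  (p : ℚ) ^ (2 * ⌈t⌉₊ + 3) / ((p : ℚ) - 1) *
      ∏ k ∈ Finset.range (⌈t⌉₊ + 1), ((k : ℚ) + ((p : ℚ) + 1) / p) ^ 2
    - ((p : ℚ) - 1) * ∑ k ∈ Finset.range (⌈t⌉₊ + 1), ((k : ℚ) + 1) * (p : ℚ) ^ k *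
      ∏ l ∈ Finset.range k, ((l : ℚ) + ((p : ℚ) + 1) / p)

/-! ### The limit defining `evalXY` exists and is unique -/

lemma absFlat_le_of_coeff_eq_zero {x : OCpFlat p} {m : ℕ} (hx : PreTilt.coeff m x = 0) :
    (absFlat x : ℝ) ≤ (1 / (p : ℝ)) ^ p ^ m := by
  have hp0 : (0 : ℝ) < p := by exact_mod_cast (Fact.out : p.Prime).pos
  by_cases h0 : x = 0
  · subst h0; rw [map_zero]; simp only [NNReal.coe_zero]; positivity
  obtain ⟨n, hn⟩ : ∃ n, PreTilt.coeff n x ≠ 0 := not_forall.1 fun h => h0 <| Perfection.ext h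
  have hmn : m ≤ n := by
    by_contra hlt
    exact (Perfection.coeff_ne_zero_of_le (p := p) hn (not_le.1 hlt).le) hx
  obtain ⟨k, rfl⟩ := Nat.exists_eq_add_of_le hmn
  have hv := PreTilt.valAux_eq (K := ℂ_[p]) (v := (PadicComplex.valued p).v)
    (hv := PadicComplexInt.integers p) hn
  obtain ⟨r, hr⟩ := Ideal.Quotient.mk_surjective (PreTilt.coeff (m + k) x)
  have hpow : PreTilt.coeff (m + k) x ^ p ^ k = 0 := by
    rw [← hx]; exact Perfection.coeffMonoidHom_pow_p_pow' x m k
  rw [← hr, ← map_pow] at hpow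
  have hle : (PadicComplex.valued p).v (algebraMap 𝓞_ℂ_[p] ℂ_[p] (r ^ p ^ k)) ≤
      (PadicComplex.valued p).v (p : ℂ_[p]) := by
    by_contra hcon
    exact (ModP.v_p_lt_val (PadicComplexInt.integers p)).1 (not_le.1 hcon) hpow
  rw [PadicComplex.valuation_p, map_pow, map_pow] at hle
  have hval : absFlat x = ((PadicComplex.valued p).v (algebraMap 𝓞_ℂ_[p] ℂ_[p] r)) ^ p ^ (m + k) := by
    rw [← ModP.preVal_mk (PadicComplexInt.integers p) (by rw [hr]; exact hn), hr]
    exact hv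
  rw [hval, add_comm m k, pow_add, pow_mul]
  have := pow_le_pow_left₀ zero_le hle (p ^ m)
  exact_mod_cast this

lemma pow_le_vFlat_of_coeff_eq_zero {x : OCpFlat p} {m : ℕ} (hx : PreTilt.coeff m x = 0) :
    (((p : ℝ) ^ m : ℝ) : EReal) ≤ vFlat x := by
  unfold vFlat
  split_ifs with h0
  · exact le_top
  have hp1 : (1 : ℝ) < p := by exact_mod_cast (Fact.out : p.Prime).one_lt
  have hpos : (0 : ℝ) < absFlat x := by
    have : absFlat x ≠ 0 := fun h => h0 ((PreTilt.map_eq_zero (PadicComplexInt.integers p)).1 h)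
    exact_mod_cast this.bot_lt
  have h := Real.logb_le_logb_of_le hp1 hpos (absFlat_le_of_coeff_eq_zero hx)
  rw [one_div, inv_pow, Real.logb_inv, Real.logb_pow, Real.logb_self_eq_one hp1] at h
  rw [EReal.coe_le_coe_iff]
  push_cast at h
  linarith

lemma coeff_pow_eq_zero {α : OCpFlat p} (hα : PreTilt.coeff 0 α = 0) {m i : ℕ} (hi : p ^ m ≤ i) :
    PreTilt.coeff m α ^ i = 0 := by
  have h : PreTilt.coeff m α ^ p ^ m = 0 := by
    rw [← hα]; exact Perfection.coeffMonoidHom_pow_p_pow_self α m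
  exact pow_eq_zero_of_le hi h

lemma coeff_partialSum_eq {α β : OCpFlat p} (hα : PreTilt.coeff 0 α = 0)
    (hβ : PreTilt.coeff 0 β = 0) (F : MvPowerSeries (Fin 2) (ZMod p)) {m n : ℕ} (hn : p ^ m ≤ n) :
    PreTilt.coeff m (partialSum α β F n) = PreTilt.coeff m (partialSum α β F (p ^ m)) := by
  have hsub : Finset.range (p ^ m + 1) ⊆ Finset.range (n + 1) :=
    Finset.range_subset_range.2 (by omega)
  simp only [partialSum, map_sum, map_mul, map_pow]
  symm
  refine (Finset.sum_subset hsub fun i _ hi => ?_).trans (Finset.sum_congr rfl fun i _ => ?_)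
  · refine Finset.sum_eq_zero fun j _ => ?_
    rw [coeff_pow_eq_zero hα (by simp at hi; omega)]; simp
  · refine Finset.sum_subset hsub fun j _ hj => ?_
    rw [coeff_pow_eq_zero hβ (by simp at hj; omega)]; simp

theorem exists_isValueAt {α β : OCpFlat p} (hα : PreTilt.coeff 0 α = 0)
    (hβ : PreTilt.coeff 0 β = 0) (F : MvPowerSeries (Fin 2) (ZMod p)) :
    ∃ y, IsValueAt α β F y := by
  have hp1 : 1 < p := (Fact.out : p.Prime).one_lt
  let y : OCpFlat p := ⟨fun m => PreTilt.coeff m (partialSum α β F (p ^ m)), fun m => by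
    dsimp only
    rw [← coeff_partialSum_eq hα hβ F (Nat.pow_le_pow_right hp1.le (Nat.le_succ m))]
    exact PreTilt.coeff_pow_p _ m⟩
  refine ⟨y, fun c => ?_⟩
  obtain ⟨m, hm⟩ := pow_unbounded_of_one_lt c (show (1 : ℝ) < p by exact_mod_cast hp1)
  filter_upwards [Filter.eventually_ge_atTop (p ^ m)] with n hn
  refine le_trans (EReal.coe_le_coe_iff.2 hm.le) (pow_le_vFlat_of_coeff_eq_zero ?_)
  rw [map_sub, coeff_partialSum_eq hα hβ F hn, sub_eq_zero]
  rfl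

/-- If `α` and `β` have zero component modulo `p`, the limit defining `f(α, β)` exists. -/
theorem isValueAt_evalXY {α β : OCpFlat p} (hα : PreTilt.coeff 0 α = 0)
    (hβ : PreTilt.coeff 0 β = 0) (F : MvPowerSeries (Fin 2) (ZMod p)) :
    IsValueAt α β F (evalXY α β F) := by
  have h := exists_isValueAt hα hβ F
  rw [evalXY, dif_pos h]
  exact h.choose_spec

lemma le_vFlat_iff {x : OCpFlat p} {c : ℝ} :
    (c : EReal) ≤ vFlat x ↔ (absFlat x : ℝ) ≤ (p : ℝ) ^ (-c) := by
  have hp1 : (1 : ℝ) < p := by exact_mod_cast (Fact.out : p.Prime).one_lt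
  unfold vFlat
  split_ifs with h0
  · subst h0
    simp only [le_top, map_zero, NNReal.coe_zero, true_iff]
    positivity
  have hpos : (0 : ℝ) < absFlat x := by
    have : absFlat x ≠ 0 := fun h => h0 ((PreTilt.map_eq_zero (PadicComplexInt.integers p)).1 h)
    exact_mod_cast this.bot_lt
  rw [EReal.coe_le_coe_iff, ← Real.logb_le_iff_le_rpow hp1 hpos]
  constructor <;> intro h <;> linarith

theorem IsValueAt.unique {α β : OCpFlat p} {F : MvPowerSeries (Fin 2) (ZMod p)} {y z : OCpFlat p}
    (hy : IsValueAt α β F y) (hz : IsValueAt α β F z) : y = z := by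
  by_contra hne
  have h0 : y - z ≠ 0 := sub_ne_zero.2 hne
  have hle : ∀ c : ℝ, (c : EReal) ≤ vFlat (y - z) := fun c => by
    obtain ⟨n, h1, h2⟩ := ((hy c).and (hz c)).exists
    rw [le_vFlat_iff] at h1 h2 ⊢
    have h3 := absFlat.map_sub (partialSum α β F n - z) (partialSum α β F n - y)
    rw [show partialSum α β F n - z - (partialSum α β F n - y) = y - z by ring] at h3
    exact (NNReal.coe_le_coe.2 h3).trans (by rw [NNReal.coe_max]; exact max_le h2 h1)
  have h4 := hle (-Real.logb p (absFlat (y - z) : ℝ) + 1)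
  rw [vFlat, if_neg h0, EReal.coe_le_coe_iff] at h4
  linarith

/-- The first component of `(π, π ^ (1/p), …)` vanishes modulo `p`. -/
theorem coeff_zero_ofRoots_uniformizer {π : ℤ_[p]} (hπ : Irreducible π) {a : ℕ → 𝓞_ℂ_[p]}
    (ha0 : (a 0 : ℂ_[p]) = algebraMap ℚ_[p] ℂ_[p] (π : ℚ_[p])) (ha : ∀ n, a (n + 1) ^ p = a n) :
    PreTilt.coeff 0 (ofRoots a ha) = 0 := by
  by_contra hne
  have h : (Ideal.Quotient.mk _ (a 0) : ModP 𝓞_ℂ_[p] p) ≠ 0 := hne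
  rw [← ModP.v_p_lt_val (PadicComplexInt.integers p), PadicComplex.valuation_p] at h
  have h1 : ‖π‖ < 1 := PadicInt.mem_nonunits.1 hπ.not_isUnit
  obtain ⟨b, hb⟩ := (PadicInt.norm_lt_one_iff_dvd π).1 h1
  have h2 : ‖(π : ℚ_[p])‖ ≤ 1 / p := by
    rw [hb, PadicInt.coe_mul, norm_mul, PadicInt.coe_natCast, Padic.norm_p, one_div]
    exact mul_le_of_le_one_right (by positivity) b.2
  have h3 : (((PadicComplex.valued p).v (algebraMap ℚ_[p] ℂ_[p] (π : ℚ_[p])) : ℝ≥0) : ℝ) =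
      ‖(π : ℚ_[p])‖ := by
    rw [IsScalarTower.algebraMap_apply ℚ_[p] (PadicAlgCl p) ℂ_[p], ← PadicComplex.coe_eq,
      PadicComplex.valuation_extends, PadicAlgCl.valuation_coe]
    exact PadicAlgCl.norm_extends p _
  have h4 : (PadicComplex.valued p).v (algebraMap 𝓞_ℂ_[p] ℂ_[p] (a 0)) ≤ 1 / (p : ℝ≥0) := by
    rw [show algebraMap 𝓞_ℂ_[p] ℂ_[p] (a 0) = (a 0 : ℂ_[p]) from rfl, ha0, ← NNReal.coe_le_coe, h3]
    simpa using h2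
  exact absurd h4 (not_le.2 h)

/-- The first component of `ε - 1 = (1, ζ_p, ζ_{p ^ 2}, …) - 1` vanishes. -/
theorem coeff_zero_ofRoots_one {a : ℕ → 𝓞_ℂ_[p]} (ha0 : a 0 = 1) (ha : ∀ n, a (n + 1) ^ p = a n) :
    PreTilt.coeff 0 (ofRoots a ha - 1) = 0 := by
  rw [map_sub, map_one, sub_eq_zero]
  change (Ideal.Quotient.mk _ (a 0) : ModP 𝓞_ℂ_[p] p) = 1
  rw [ha0, map_one]

end FalseTate

end

/-!
The valuation of `f = F(u, η)` exceeds `w = v_mono(f)` by at most a quadratic function of `w`, and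
`𝔐(w)` is far larger than that.

Let `τ` be the substitution `u ↦ u * ε`, `η ↦ η`, with `ε = 1 + η`. It preserves the valuation of
polynomials in `u` and `η` (`absFlat_partialSum_mul_pow`): on the `n`-th component of
`O_{ℂ_p}^♭` it is induced by an element of the Galois group of `ℚ_p(ζ)`, for `ζ` a primitive
`p ^ n`-th root of unity, that multiplies `π ^ (1 / p ^ n)` by `ζ`. Such an element exists
(`exists_gal_kummer`) because `X ^ (p ^ n) - π` is irreducible over `ℚ_p(ζ)`, and this in turn holds
because `ℚ_p(ζ)` is abelian over `ℚ_p` and so contains no `p`-th root of `π`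
(`pow_ne_uniformizer`).

Among the monomials of `F` of least valuation `w` at `(u, η)`, let `X ^ n Y ^ j₀` have the largest
`n`. Apply `∏_{k < n} (τ - ε ^ k)` to `f`. This does not decrease the lower bounds for the valuation
(`map_sum_qFactor_le`), and it multiplies `u ^ i` by `∏_{k < n} (ε ^ i - ε ^ k)`, which vanishes for
`i < n` and is divisible by its value at `i = n` for `i ≥ n`, the quotient being a Gaussian binomial
coefficient (`qFactor_self_dvd`). So the monomial `u ^ n * η ^ j₀` strictly dominates the result
(`absFlat_sum_qFactor`), and
`v^♭(f) ≤ w + ∑_{1 ≤ k ≤ n} v^♭(ε ^ k - 1) ≤ w + p / (p - 1) * (n * (n + 1) / 2)`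
(`le_weight_add`). Here `n ≤ w` because `v^♭(u) = 1`. To avoid limits, all this is done for a
partial sum of `F` close enough to `f`.
-/

open scoped NNReal

noncomputable section

namespace FalseTate

/-! ### Kummer theory over the cyclotomic extensions of `ℚ_p` -/

section

variable {p : ℕ} [Fact p.Prime]

open Polynomial IntermediateField

/-- The valuation on `ℚ_p` is integer-valued, so `1` is not a proper multiple of a value. -/
lemma padic_norm_pow_ne {k : ℕ} (hk : 2 ≤ k) (z : ℚ_[p]) : ‖z‖ ^ k ≠ (p : ℝ)⁻¹ := by
  have hp1 : (1 : ℝ) < p := by exact_mod_cast (Fact.out : p.Prime).one_lt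
  intro h
  have hz : z ≠ 0 := by
    rintro rfl
    rw [norm_zero, zero_pow (by omega)] at h
    have : (0 : ℝ) < (p : ℝ)⁻¹ := by positivity
    exact this.ne h
  rw [Padic.norm_eq_zpow_neg_valuation hz, ← zpow_natCast, ← zpow_mul, ← zpow_neg_one] at h
  have h2 := zpow_right_injective₀ (by positivity) hp1.ne' h
  have h3 : z.valuation * (k : ℤ) = 1 := by linarith
  rcases Int.mul_eq_one_iff_eq_one_or_neg_one.1 h3 with h4 | h4 <;> omega

lemma norm_pow_sub_one_le {z : PadicAlgCl p} (hz : ‖z‖ = 1) (i : ℕ) : ‖z ^ i - 1‖ ≤ ‖z - 1‖ := by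
  rw [← geom_sum_mul, norm_mul]
  refine mul_le_of_le_one_left (norm_nonneg _) ?_
  refine IsUltrametricDist.norm_sum_le_of_forall_le_of_nonneg zero_le_one fun j _ => ?_
  rw [norm_pow, hz, one_pow]

/-- `v_p(ζ_p - 1) = 1 / (p - 1)`: the factors `1 - ζ_p ^ i` of `Φ_p(1) = p` have equal norm. -/
lemma norm_sub_one_pow {z : PadicAlgCl p} (hz : IsPrimitiveRoot z p) :
    ‖z - 1‖ ^ (p - 1) = (p : ℝ)⁻¹ := by
  have hpp : p.Prime := Fact.out
  have hone : ∀ y : PadicAlgCl p, IsPrimitiveRoot y p → ‖y‖ = 1 := fun y hy =>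
    (pow_eq_one_iff_of_nonneg (norm_nonneg y) hpp.ne_zero).1
      (by rw [← norm_pow, hy.pow_eq_one, norm_one])
  have hle : ∀ y y' : PadicAlgCl p, IsPrimitiveRoot y p → IsPrimitiveRoot y' p →
      ‖y' - 1‖ ≤ ‖y - 1‖ := fun y y' hy hy' => by
    obtain ⟨i, -, rfl⟩ := hy.eq_pow_of_pow_eq_one hy'.pow_eq_one
    exact norm_pow_sub_one_le (hone y hy) i
  have h1 : (eval 1 (cyclotomic p (PadicAlgCl p))) = p := eval_one_cyclotomic_prime
  rw [cyclotomic_eq_prod_X_sub_primitiveRoots hz, eval_prod] at h1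
  have h2 := congrArg norm h1
  rw [norm_prod, Finset.prod_congr rfl (g := fun _ => ‖z - 1‖) (fun y hy => ?_),
    Finset.prod_const, hz.card_primitiveRoots, Nat.totient_prime hpp] at h2
  · rw [h2, ← map_natCast (algebraMap ℚ_[p] (PadicAlgCl p)), norm_algebraMap', Padic.norm_p]
  · have hy' : IsPrimitiveRoot y p := (mem_primitiveRoots hpp.pos).1 hy
    rw [eval_sub, eval_X, eval_C, norm_sub_rev]
    exact le_antisymm (hle _ _ hz hy') (hle _ _ hy' hz)

/-- A uniformizer of `ℚ_p` has no `p`-th root in a cyclotomic extension `ℚ_p(ζ)`: this extension is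
abelian, so `ℚ_p(π ^ (1 / p))` would be normal over `ℚ_p`, hence contain `ζ_p`, whose degree is
coprime to `p`. -/
lemma pow_ne_uniformizer (hp : 3 ≤ p) {π : ℚ_[p]} (hπ : ‖π‖ = (p : ℝ)⁻¹) {n : ℕ}
    {z : PadicAlgCl p} (hz : IsPrimitiveRoot z (p ^ n)) (b : ℚ_[p]⟮z⟯) :
    b ^ p ≠ algebraMap ℚ_[p] ℚ_[p]⟮z⟯ π := by
  have hpp : p.Prime := Fact.out
  intro hb
  have : NeZero ((p ^ n : ℕ) : ℚ_[p]) := ⟨by simp [hpp.ne_zero]⟩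
  have : NeZero (p ^ n) := ⟨by simp [hpp.ne_zero]⟩
  have hcyc : IsCyclotomicExtension {p ^ n} ℚ_[p] ℚ_[p]⟮z⟯ :=
    hz.intermediateField_adjoin_isCyclotomicExtension ℚ_[p]
  have hab : IsAbelianGalois ℚ_[p] ℚ_[p]⟮z⟯ := IsCyclotomicExtension.isAbelianGalois {p ^ n} _ _
  have hirr : Irreducible (X ^ p - C π) := X_pow_sub_C_irreducible_of_prime hpp fun c hc =>
    padic_norm_pow_ne (by omega : 2 ≤ p) c (by rw [← norm_pow, hc, hπ])
  have hroot : aeval b (X ^ p - C π) = 0 := by simp [hb]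
  have hmin : minpoly ℚ_[p] b = X ^ p - C π :=
    (minpoly.eq_of_irreducible_of_monic hirr hroot (monic_X_pow_sub_C π hpp.ne_zero)).symm
  set L : IntermediateField ℚ_[p] ℚ_[p]⟮z⟯ := ℚ_[p]⟮b⟯ with hL
  have hint : IsIntegral ℚ_[p] b :=
    ⟨_, monic_X_pow_sub_C π hpp.ne_zero, hroot⟩
  have hfin : Module.finrank ℚ_[p] L = p := by
    rw [hL, adjoin.finrank hint, hmin, natDegree_X_pow_sub_C]
  obtain ⟨w, hw⟩ := HasEnoughRootsOfUnity.exists_primitiveRoot (PadicAlgCl p) p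
  have hb0 : b ≠ 0 := by
    rintro rfl
    rw [zero_pow hpp.ne_zero, eq_comm, map_eq_zero] at hb
    rw [hb, norm_zero] at hπ
    have : (0 : ℝ) < (p : ℝ)⁻¹ := by have := hpp.pos; positivity
    exact this.ne hπ
  -- `L` is normal, so it contains the conjugate `w * b` of `b`, and therefore `w`
  have hsplit : ((X ^ p - C π).map (algebraMap ℚ_[p] L)).Splits := by
    have := Normal.splits (inferInstance : Normal ℚ_[p] L) (AdjoinSimple.gen ℚ_[p] b)
    rwa [minpoly_gen, hmin] at this
  have hrange : w * (b : PadicAlgCl p) ∈ (algebraMap L (PadicAlgCl p)).range := by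
    refine hsplit.mem_range_of_isRoot
      ((monic_X_pow_sub_C π hpp.ne_zero).map _).ne_zero ?_
    rw [IsRoot, eval_map, eval₂_map, ← IsScalarTower.algebraMap_eq, ← aeval_def]
    have hb' : (b : PadicAlgCl p) ^ p = algebraMap ℚ_[p] (PadicAlgCl p) π := by
      rw [← SubmonoidClass.coe_pow, hb]; rfl
    simp [mul_pow, hw.pow_eq_one, hb']
  obtain ⟨c, hc⟩ := hrange
  have hbgen : algebraMap L (PadicAlgCl p) (AdjoinSimple.gen ℚ_[p] b) = b := rfl
  obtain ⟨y, hy⟩ : ∃ y : L, algebraMap L (PadicAlgCl p) y = w := by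
    refine ⟨c / AdjoinSimple.gen ℚ_[p] b, ?_⟩
    rw [map_div₀, hc, hbgen, mul_div_cancel_right₀]
    simpa using hb0
  have hyw : IsPrimitiveRoot y p :=
    IsPrimitiveRoot.of_map_of_injective (f := algebraMap L (PadicAlgCl p)) (by rwa [hy])
      (algebraMap L (PadicAlgCl p)).injective
  have hdeg : (minpoly ℚ_[p] y).natDegree = 1 := by
    have hfd : FiniteDimensional ℚ_[p] L := adjoin.finiteDimensional hint
    have hdvd : (minpoly ℚ_[p] y).natDegree ∣ p := by
      have := minpoly.degree_dvd (IsIntegral.of_finite ℚ_[p] y)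
      rwa [hfin] at this
    -- the degree of `ζ_p` divides `p` and is at most `p - 1`
    refine ((Nat.dvd_prime hpp).1 hdvd).resolve_right fun h => ?_
    have hcy : aeval y (cyclotomic p ℚ_[p]) = 0 := by
      rw [aeval_def, ← eval_map, map_cyclotomic]
      exact hyw.isRoot_cyclotomic hpp.pos
    have h2 := natDegree_le_of_dvd (minpoly.dvd _ _ hcy) (cyclotomic_ne_zero p _)
    rw [natDegree_cyclotomic, Nat.totient_prime hpp] at h2
    omega
  obtain ⟨q, hq⟩ := minpoly.natDegree_eq_one_iff.1 hdeg
  have hqw : algebraMap ℚ_[p] (PadicAlgCl p) q = w := by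
    rw [← hy, ← hq]; rfl
  have h3 := norm_sub_one_pow hw
  rw [← hqw, ← map_one (algebraMap ℚ_[p] (PadicAlgCl p)), ← map_sub, norm_algebraMap'] at h3
  exact padic_norm_pow_ne (by omega) _ h3

/-- Kummer theory: over `ℚ_p(z)`, where `z` is a primitive `p ^ n`-th root of unity, a `p ^ n`-th
root `x` of a uniformizer is conjugate to each `x * z ^ a`. -/
lemma exists_gal_kummer (hp : 3 ≤ p) {π : ℚ_[p]} (hπ : ‖π‖ = (p : ℝ)⁻¹) {n : ℕ}
    {z x : PadicAlgCl p} (hz : IsPrimitiveRoot z (p ^ n))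
    (hx : x ^ p ^ n = algebraMap ℚ_[p] (PadicAlgCl p) π) (a : ℕ) :
    ∃ σ : Gal(PadicAlgCl p/ℚ_[p]), σ x = x * z ^ a ∧ σ z = z := by
  have hpp : p.Prime := Fact.out
  have hpn : p ^ n ≠ 0 := pow_ne_zero _ hpp.ne_zero
  set K := ℚ_[p]⟮z⟯
  set q : K[X] := X ^ p ^ n - C (algebraMap ℚ_[p] K π) with hq
  have hirr : Irreducible q :=
    X_pow_sub_C_irreducible_of_prime_pow hpp (by omega) n (pow_ne_uniformizer hp hπ hz)
  have hmin : ∀ y : PadicAlgCl p, y ^ p ^ n = algebraMap ℚ_[p] (PadicAlgCl p) π →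
      minpoly K y = q := fun y hy =>
    (minpoly.eq_of_irreducible_of_monic hirr
      (by simp [hq, hy, ← IsScalarTower.algebraMap_apply]) (monic_X_pow_sub_C _ hpn)).symm
  have hx' : (x * z ^ a) ^ p ^ n = algebraMap ℚ_[p] (PadicAlgCl p) π := by
    rw [mul_pow, hx, ← pow_mul, mul_comm a, pow_mul, hz.pow_eq_one, one_pow, mul_one]
  have hconj : IsConjRoot K (x * z ^ a) x := (hmin _ hx').trans (hmin _ hx).symm
  have : Normal K (PadicAlgCl p) := Normal.tower_top_of_normal ℚ_[p] K (PadicAlgCl p)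
  obtain ⟨σ, hσ⟩ := isConjRoot_iff_exists_algEquiv.1 hconj
  exact ⟨σ.restrictScalars ℚ_[p], hσ, σ.commutes (AdjoinSimple.gen ℚ_[p] z)⟩

lemma norm_gal_apply (σ : Gal(PadicAlgCl p/ℚ_[p])) (x : PadicAlgCl p) : ‖σ x‖ = ‖x‖ :=
  (spectralNorm_eq_of_equiv σ x).symm

end

/-! ### The valuation on the tilt and its Galois invariance -/

section

variable {p : ℕ} [Fact p.Prime]

lemma norm_uniformizer {π : ℤ_[p]} (hπ : Irreducible π) : ‖(π : ℚ_[p])‖ = (p : ℝ)⁻¹ := by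
  obtain ⟨c, hc⟩ := IsDiscreteValuationRing.associated_of_irreducible ℤ_[p] PadicInt.irreducible_p hπ
  have h := congrArg norm hc
  rw [norm_mul, PadicInt.norm_p, PadicInt.norm_units, mul_one] at h
  exact h.symm

lemma valued_algebraMap (x : PadicAlgCl p) :
    ((Valued.v (algebraMap (PadicAlgCl p) ℂ_[p] x) : ℝ≥0) : ℝ) = ‖x‖ := by
  rw [← PadicComplex.coe_eq, PadicComplex.valuation_extends, PadicAlgCl.valuation_coe]

/-- Roots in `ℂ_p` of algebraic elements are algebraic, so the Galois group acts on them. -/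
lemma exists_algebraMap_of_pow_eq {k : ℕ} (hk : k ≠ 0) {y : ℂ_[p]} {c : PadicAlgCl p}
    (h : y ^ k = algebraMap (PadicAlgCl p) ℂ_[p] c) :
    ∃ x : PadicAlgCl p, algebraMap (PadicAlgCl p) ℂ_[p] x = y := by
  have hs : (Polynomial.X ^ k - Polynomial.C c).Splits := IsAlgClosed.splits _
  refine hs.mem_range_of_isRoot (Polynomial.monic_X_pow_sub_C c hk).ne_zero ?_
  simp [Polynomial.IsRoot, h]

lemma coeff_ofRoots (a : ℕ → 𝓞_ℂ_[p]) (ha : ∀ n, a (n + 1) ^ p = a n) (n : ℕ) :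
    PreTilt.coeff n (ofRoots a ha) = Ideal.Quotient.mk _ (a n) := rfl

lemma coeff_ne_zero_of_lift {x : OCpFlat p} {n : ℕ} {r : 𝓞_ℂ_[p]}
    (hr : PreTilt.coeff n x = Ideal.Quotient.mk _ r) :
    PreTilt.coeff n x ≠ 0 ↔ 1 / (p : ℝ≥0) < Valued.v (r : ℂ_[p]) := by
  rw [hr, ← PadicComplex.valuation_p]
  exact (ModP.v_p_lt_val (PadicComplexInt.integers p)).symm

lemma absFlat_eq_of_lift {x : OCpFlat p} {n : ℕ} {r : 𝓞_ℂ_[p]}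
    (hr : PreTilt.coeff n x = Ideal.Quotient.mk _ r)
    (h : 1 / (p : ℝ≥0) < Valued.v (r : ℂ_[p])) :
    absFlat x = (Valued.v (r : ℂ_[p])) ^ p ^ n := by
  have hn := (coeff_ne_zero_of_lift hr).2 h
  have hv := PreTilt.valAux_eq (K := ℂ_[p]) (v := (PadicComplex.valued p).v)
    (hv := PadicComplexInt.integers p) hn
  have h1 := ModP.preVal_mk (K := ℂ_[p]) (v := (PadicComplex.valued p).v)
    (PadicComplexInt.integers p) (x := r) (by rw [← hr]; exact hn)
  rw [hr, h1] at hv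
  exact hv

lemma absFlat_le_one (x : OCpFlat p) : absFlat x ≤ 1 := by
  by_cases h0 : x = 0
  · rw [h0, map_zero]; exact zero_le_one
  obtain ⟨n, hn⟩ : ∃ n, PreTilt.coeff n x ≠ 0 := not_forall.1 fun h => h0 <| Perfection.ext h
  obtain ⟨r, hr⟩ := Ideal.Quotient.mk_surjective (PreTilt.coeff n x)
  rw [absFlat_eq_of_lift hr.symm ((coeff_ne_zero_of_lift hr.symm).1 hn)]
  exact pow_le_one₀ zero_le r.2

/-- The valuation of an element only depends on the valuations of lifts of its components. -/
lemma absFlat_congr {x y : OCpFlat p} (r s : ℕ → 𝓞_ℂ_[p])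
    (hr : ∀ n, PreTilt.coeff n x = Ideal.Quotient.mk _ (r n))
    (hs : ∀ n, PreTilt.coeff n y = Ideal.Quotient.mk _ (s n))
    (h : ∀ n, Valued.v (r n : ℂ_[p]) = Valued.v (s n : ℂ_[p])) : absFlat x = absFlat y := by
  by_cases h0 : ∃ n, PreTilt.coeff n x ≠ 0
  · obtain ⟨n, hn⟩ := h0
    have h1 := (coeff_ne_zero_of_lift (hr n)).1 hn
    rw [absFlat_eq_of_lift (hr n) h1, h n, absFlat_eq_of_lift (hs n) (h n ▸ h1)]
  · have hx : x = 0 := Perfection.ext fun n => by_contra fun hn => h0 ⟨n, hn⟩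
    have hy : y = 0 := Perfection.ext fun n => by_contra fun hn =>
      h0 ⟨n, (coeff_ne_zero_of_lift (hr n)).2 (h n ▸ (coeff_ne_zero_of_lift (hs n)).1 hn)⟩
    rw [hx, hy]

section Roots

variable {a : ℕ → 𝓞_ℂ_[p]}

lemma compatible_pow (ha : ∀ n, a (n + 1) ^ p = a n) (n : ℕ) : a n ^ p ^ n = a 0 := by
  induction n with
  | zero => simp
  | succ n ih => rw [pow_succ', pow_mul, ha, ih]

/-- `v^♭(u) = 1`, read off from the component of index `1`, where `v_p(π ^ (1 / p)) = 1 / p < 1`. -/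
lemma absFlat_ofRoots_uniformizer {π : ℤ_[p]} (hπ : Irreducible π)
    (ha0 : (a 0 : ℂ_[p]) = algebraMap ℚ_[p] ℂ_[p] (π : ℚ_[p])) (ha : ∀ n, a (n + 1) ^ p = a n) :
    (absFlat (ofRoots a ha) : ℝ) = (p : ℝ)⁻¹ := by
  have hpp : p.Prime := Fact.out
  have hp1 : (1 : ℝ) < p := by exact_mod_cast hpp.one_lt
  have h1 : ((Valued.v (a 1 : ℂ_[p]) : ℝ≥0) : ℝ) ^ p = (p : ℝ)⁻¹ := by
    rw [← NNReal.coe_pow, ← map_pow, ← norm_uniformizer hπ,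
      show (a 1 : ℂ_[p]) ^ p = a 0 from congrArg Subtype.val (ha 0), ha0,
      IsScalarTower.algebraMap_apply ℚ_[p] (PadicAlgCl p) ℂ_[p], valued_algebraMap,
      norm_algebraMap']
  have hlt : 1 / (p : ℝ≥0) < Valued.v (a 1 : ℂ_[p]) := by
    rw [← NNReal.coe_lt_coe]
    refine lt_of_pow_lt_pow_left₀ p (by positivity) ?_
    rw [h1]
    push_cast
    rw [one_div]
    exact pow_lt_self_of_lt_one₀ (by positivity) (inv_lt_one_of_one_lt₀ hp1) hpp.one_lt
  rw [absFlat_eq_of_lift (coeff_ofRoots a ha 1) hlt, pow_one, NNReal.coe_pow, h1]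

/-- `v^♭(η) = p / (p - 1)`, read off from the component of index `1`, where
`v_p(ζ_p - 1) = 1 / (p - 1)`. This is less than `1` because `p ≥ 3`, so the component is nonzero. -/
lemma absFlat_ofRoots_sub_one (hp : 3 ≤ p) (hprim : ∀ n, IsPrimitiveRoot (a n) (p ^ n))
    (ha : ∀ n, a (n + 1) ^ p = a n) :
    (absFlat (ofRoots a ha - 1) : ℝ) ^ (p - 1) = (p : ℝ)⁻¹ ^ p := by
  have hpp : p.Prime := Fact.out
  have hp1 : (1 : ℝ) < p := by exact_mod_cast hpp.one_lt
  have hprim1 : IsPrimitiveRoot (a 1 : ℂ_[p]) p := by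
    have := (hprim 1).map_of_injective (f := algebraMap 𝓞_ℂ_[p] ℂ_[p]) Subtype.val_injective
    rwa [pow_one] at this
  obtain ⟨z, hz⟩ := exists_algebraMap_of_pow_eq (y := (a 1 : ℂ_[p])) (c := 1) hpp.ne_zero
    (by rw [hprim1.pow_eq_one, map_one])
  have hzprim : IsPrimitiveRoot z p :=
    IsPrimitiveRoot.of_map_of_injective (f := algebraMap (PadicAlgCl p) ℂ_[p]) (by rwa [hz])
      (algebraMap (PadicAlgCl p) ℂ_[p]).injective
  have h1 : ((Valued.v ((a 1 - 1 : 𝓞_ℂ_[p]) : ℂ_[p]) : ℝ≥0) : ℝ) ^ (p - 1) = (p : ℝ)⁻¹ := by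
    rw [← norm_sub_one_pow hzprim, ← valued_algebraMap, map_sub, hz, map_one]
    rfl
  have hlt : 1 / (p : ℝ≥0) < Valued.v ((a 1 - 1 : 𝓞_ℂ_[p]) : ℂ_[p]) := by
    rw [← NNReal.coe_lt_coe]
    refine lt_of_pow_lt_pow_left₀ (p - 1) (by positivity) ?_
    rw [h1]
    push_cast
    rw [one_div]
    exact pow_lt_self_of_lt_one₀ (by positivity) (inv_lt_one_of_one_lt₀ hp1) (by omega)
  have hc : PreTilt.coeff 1 (ofRoots a ha - 1) = Ideal.Quotient.mk _ (a 1 - 1) := by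
    rw [map_sub, map_one, coeff_ofRoots, map_sub, map_one]
  rw [absFlat_eq_of_lift hc hlt, pow_one, NNReal.coe_pow, ← pow_mul, mul_comm, pow_mul, h1]

end Roots

lemma coeff_castHom (n : ℕ) (c : ZMod p) :
    PreTilt.coeff n (ZMod.castHom (dvd_refl p) (OCpFlat p) c) =
      Ideal.Quotient.mk _ ((c.val : ℕ) : 𝓞_ℂ_[p]) := by
  conv_lhs => rw [← ZMod.natCast_zmod_val c]
  rw [map_natCast, map_natCast, map_natCast]

/-- Substituting `u * ε ^ a` for `u` does not change the valuation of a polynomial in `u` and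
`η = ε - 1`: on each component it is a Galois conjugation. -/
theorem absFlat_partialSum_mul_pow (hp : 3 ≤ p) {π : ℤ_[p]} (hπ : Irreducible π)
    {ϖ : ℕ → 𝓞_ℂ_[p]} (hϖ0 : (ϖ 0 : ℂ_[p]) = algebraMap ℚ_[p] ℂ_[p] (π : ℚ_[p]))
    (hϖ : ∀ n, ϖ (n + 1) ^ p = ϖ n)
    {ζ : ℕ → 𝓞_ℂ_[p]} (hprim : ∀ n, IsPrimitiveRoot (ζ n) (p ^ n))
    (hζ : ∀ n, ζ (n + 1) ^ p = ζ n) (F : MvPowerSeries (Fin 2) (ZMod p)) (N a : ℕ) :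
    absFlat (partialSum (ofRoots ϖ hϖ * ofRoots ζ hζ ^ a) (ofRoots ζ hζ - 1) F N) =
      absFlat (partialSum (ofRoots ϖ hϖ) (ofRoots ζ hζ - 1) F N) := by
  have hpp : p.Prime := Fact.out
  -- the partial sum with coefficients lifted to `ℕ`, in an arbitrary commutative ring
  let S : ∀ {R : Type} [CommRing R], R → R → R := fun x z =>
    ∑ i ∈ Finset.range (N + 1), ∑ j ∈ Finset.range (N + 1),
      ((coeffXY F i j).val : _) * x ^ i * (z - 1) ^ j
  have hS : ∀ {R R' : Type} [CommRing R] [CommRing R'] (φ : R →+* R') (x z : R),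
      φ (S x z) = S (φ x) (φ z) := fun φ x z => by
    simp only [S, map_sum, map_mul, map_pow, map_sub, map_one, map_natCast]
  refine absFlat_congr (fun n => S (ϖ n * ζ n ^ a) (ζ n)) (fun n => S (ϖ n) (ζ n))
    (fun n => ?_) (fun n => ?_) fun n => ?_
  · simp only [S, partialSum, map_sum, map_mul, map_pow, map_sub, map_one, coeff_castHom,
      coeff_ofRoots]
  · simp only [S, partialSum, map_sum, map_mul, map_pow, map_sub, map_one, coeff_castHom,
      coeff_ofRoots]
  · have hpn : p ^ n ≠ 0 := pow_ne_zero _ hpp.ne_zero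
    have hprimn : IsPrimitiveRoot (ζ n : ℂ_[p]) (p ^ n) :=
      (hprim n).map_of_injective (f := algebraMap 𝓞_ℂ_[p] ℂ_[p]) Subtype.val_injective
    obtain ⟨z, hz⟩ := exists_algebraMap_of_pow_eq (y := (ζ n : ℂ_[p])) (c := 1) hpn
      (by rw [hprimn.pow_eq_one, map_one])
    have hzprim : IsPrimitiveRoot z (p ^ n) :=
      IsPrimitiveRoot.of_map_of_injective (f := algebraMap (PadicAlgCl p) ℂ_[p]) (by rwa [hz])
        (algebraMap (PadicAlgCl p) ℂ_[p]).injective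
    have hϖn : (ϖ n : ℂ_[p]) ^ p ^ n =
        algebraMap (PadicAlgCl p) ℂ_[p] (algebraMap ℚ_[p] (PadicAlgCl p) π) := by
      rw [← IsScalarTower.algebraMap_apply, ← hϖ0]
      exact congrArg Subtype.val (compatible_pow hϖ n)
    obtain ⟨x, hx⟩ := exists_algebraMap_of_pow_eq hpn hϖn
    have hxpow : x ^ p ^ n = algebraMap ℚ_[p] (PadicAlgCl p) π :=
      (algebraMap (PadicAlgCl p) ℂ_[p]).injective (by rw [map_pow, hx, hϖn])
    obtain ⟨σ, hσx, hσz⟩ := exists_gal_kummer hp (norm_uniformizer hπ) hzprim hxpow a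
    have h1 : ((S (ϖ n * ζ n ^ a) (ζ n) : 𝓞_ℂ_[p]) : ℂ_[p]) =
        algebraMap (PadicAlgCl p) ℂ_[p] (σ (S x z)) := by
      have e1 := hS (σ : PadicAlgCl p →+* PadicAlgCl p) x z
      have e2 := hS (algebraMap 𝓞_ℂ_[p] ℂ_[p]) (ϖ n * ζ n ^ a) (ζ n)
      refine e2.trans ?_
      rw [show σ (S x z) = S (x * z ^ a) z from e1.trans (by congr 1), hS, map_mul, map_pow,
        map_mul (algebraMap (PadicAlgCl p) ℂ_[p]), map_pow (algebraMap (PadicAlgCl p) ℂ_[p]), hx, hz]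
      rfl
    have h2 : ((S (ϖ n) (ζ n) : 𝓞_ℂ_[p]) : ℂ_[p]) =
        algebraMap (PadicAlgCl p) ℂ_[p] (S x z) := by
      refine (hS (algebraMap 𝓞_ℂ_[p] ℂ_[p]) (ϖ n) (ζ n)).trans ?_
      rw [hS, hx, hz]
      rfl
    rw [← NNReal.coe_inj, h1, h2, valued_algebraMap, valued_algebraMap, norm_gal_apply]

end

/-! ### The operator `∏_{k < n} (τ - q ^ k)` -/

section Operator

variable {R : Type*} [CommRing R]

/-- `∏_{k < n} (q ^ i - q ^ k)`, the factor by which `∏_{k < n} (τ - q ^ k)` multiplies `x ^ i` when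
`τ` is the substitution `x ↦ q * x`. It vanishes for `i < n`. -/
def qFactor (q : R) (i n : ℕ) : R := ∏ k ∈ Finset.range n, (q ^ i - q ^ k)

lemma qFactor_of_lt (q : R) {i n : ℕ} (h : i < n) : qFactor q i n = 0 :=
  Finset.prod_eq_zero (Finset.mem_range.2 h) (sub_self _)

lemma qFactor_succ (q : R) (i n : ℕ) : qFactor q i (n + 1) = qFactor q i n * (q ^ i - q ^ n) :=
  Finset.prod_range_succ _ _

lemma qFactor_succ_succ (q : R) (i n : ℕ) :
    qFactor q (i + 1) (n + 1) = (q ^ (i + 1) - 1) * q ^ n * qFactor q i n := by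
  have h : ∀ k, q ^ (i + 1) - q ^ (k + 1) = q * (q ^ i - q ^ k) := fun k => by ring
  simp only [qFactor, Finset.prod_range_succ', h, Finset.prod_mul_distrib, Finset.prod_const,
    Finset.card_range, pow_zero]
  ring

/-- The quotient is the Gaussian binomial coefficient; the induction is its Pascal rule. -/
lemma qFactor_self_dvd (q : R) (i n : ℕ) : qFactor q n n ∣ qFactor q i n := by
  induction i generalizing n with
  | zero =>
    cases n with
    | zero => exact dvd_rfl
    | succ n => rw [qFactor_of_lt q n.succ_pos]; exact dvd_zero _
  | succ i ih =>
    cases n with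
    | zero => simp [qFactor]
    | succ n =>
      have h : qFactor q (i + 1) (n + 1) =
          (q ^ (n + 1) - 1) * q ^ n * qFactor q i n + q ^ (n + 1) * qFactor q i (n + 1) := by
        rw [qFactor_succ_succ, qFactor_succ]; ring
      rw [h]
      refine dvd_add ?_ (Dvd.dvd.mul_left (ih _) _)
      rw [qFactor_succ_succ]
      exact mul_dvd_mul_left _ (ih n)

variable {Γ : Type*} [LinearOrderedCommGroupWithZero Γ] (v : Valuation R Γ)

/-- If a polynomial is bounded at all the points `x * q ^ a`, so is its image under
`∏_{k < n} (τ - q ^ k)`. -/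
lemma map_sum_qFactor_le {q : R} (hq : v q ≤ 1) (s : Finset ℕ) (g : ℕ → R) (x : R) {δ : Γ}
    (h : ∀ a, v (∑ i ∈ s, g i * (x * q ^ a) ^ i) ≤ δ) (n a : ℕ) :
    v (∑ i ∈ s, g i * (x * q ^ a) ^ i * qFactor q i n) ≤ δ := by
  induction n generalizing a with
  | zero => simpa [qFactor] using h a
  | succ n ih =>
    have e : ∑ i ∈ s, g i * (x * q ^ a) ^ i * qFactor q i (n + 1) =
        ∑ i ∈ s, g i * (x * q ^ (a + 1)) ^ i * qFactor q i n -
          q ^ n * ∑ i ∈ s, g i * (x * q ^ a) ^ i * qFactor q i n := by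
      rw [Finset.mul_sum, ← Finset.sum_sub_distrib]
      refine Finset.sum_congr rfl fun i _ => ?_
      rw [qFactor_succ]; ring
    rw [e]
    refine (v.map_sub _ _).trans (max_le (ih _) ?_)
    rw [map_mul, map_pow]
    exact (mul_le_of_le_one_left' (pow_le_one₀ zero_le hq)).trans (ih a)

/-- In characteristic `p`, `|q ^ m - 1| ≥ |q - 1| ^ m`. In fact `|q ^ m - 1| = |q - 1| ^ (p ^ s)`
where `p ^ s` is the exact power of `p` dividing `m`. -/
lemma le_map_pow_sub_one {p : ℕ} [Fact p.Prime] [CharP R p] {q : R} (hq1 : v (q - 1) < 1)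
    {m : ℕ} (hm : m ≠ 0) : v (q - 1) ^ m ≤ v (q ^ m - 1) := by
  have hpp : p.Prime := Fact.out
  induction m using Nat.strong_induction_on with
  | _ m ih =>
    by_cases hpm : p ∣ m
    · obtain ⟨k, rfl⟩ := hpm
      have hk : k ≠ 0 := by rintro rfl; simp at hm
      have h1 : q ^ (p * k) - 1 = (q ^ k - 1) ^ p := by
        rw [sub_pow_char, one_pow, ← pow_mul, mul_comm]
      rw [h1, map_pow, mul_comm p k, pow_mul]
      exact pow_le_pow_left₀ zero_le
        (ih k (lt_mul_of_one_lt_left (Nat.pos_of_ne_zero hk) hpp.one_lt) hk) p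
    · have hunit : v (m : R) = 1 := by
        -- `m` is a nonzero element of the prime field
        have hz : ((m : ZMod p)) ^ (p - 1) = 1 :=
          ZMod.pow_card_sub_one_eq_one fun h => hpm ((ZMod.natCast_eq_zero_iff m p).1 h)
        have h2 := congrArg (fun c => v (ZMod.castHom (dvd_refl p) R c)) hz
        simp only [map_pow, map_natCast, map_one] at h2
        have := hpp.two_le
        exact (pow_eq_one_iff_of_nonneg zero_le (by omega)).1 h2
      have hqle : v q ≤ 1 := by
        have := v.map_add (q - 1) 1
        rw [sub_add_cancel, map_one] at this
        exact this.trans (max_le hq1.le le_rfl)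
      -- the geometric sum is congruent to `m` modulo the maximal ideal
      have hgeom : v (∑ i ∈ Finset.range m, q ^ i) = 1 := by
        have e : ∑ i ∈ Finset.range m, q ^ i = (m : R) + ∑ i ∈ Finset.range m, (q ^ i - 1) := by
          simp [Finset.sum_sub_distrib]
        rw [e, v.map_add_eq_of_lt_left, hunit]
        rw [hunit]
        refine v.map_sum_lt one_ne_zero fun i _ => ?_
        rw [← geom_sum_mul, map_mul]
        refine (mul_le_of_le_one_left' (v.map_sum_le fun j _ => ?_)).trans_lt hq1
        rw [map_pow]
        exact pow_le_one₀ zero_le hqle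
      rw [← geom_sum_mul, map_mul, hgeom, one_mul]
      exact pow_le_of_le_one zero_le hq1.le hm

/-- The exponent is `1 + 2 + ⋯ + n`, since up to units the factors are `q ^ k - 1`, `1 ≤ k ≤ n`. -/
lemma le_map_qFactor_self {p : ℕ} [Fact p.Prime] [CharP R p] {q : R} (hq1 : v (q - 1) < 1)
    (n : ℕ) : v (q - 1) ^ (n * (n + 1) / 2) ≤ v (qFactor q n n) := by
  have hq : v q = 1 := by
    have := v.map_add_eq_of_lt_right (x := q - 1) (y := 1) (by rwa [map_one])
    rwa [sub_add_cancel, map_one] at this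
  induction n with
  | zero => simp [qFactor]
  | succ n ih =>
    have h : (n + 1) * (n + 1 + 1) / 2 = (n + 1) + n * (n + 1) / 2 := by
      rw [show (n + 1) * (n + 1 + 1) = n * (n + 1) + (n + 1) * 2 by ring,
        Nat.add_mul_div_right _ _ two_pos, add_comm]
    rw [qFactor_succ_succ, h, pow_add, map_mul, map_mul, map_pow, hq, one_pow, mul_one]
    exact mul_le_mul' (le_map_pow_sub_one v hq1 n.succ_ne_zero) ih

end Operator

/-! ### Bounds for `𝔐` -/

section Numeric

variable {p : ℕ}

/-- `∏_{k ≤ m} (k + (p + 1) / p)`. -/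
def risingProd (p m : ℕ) : ℚ := ∏ k ∈ Finset.range (m + 1), ((k : ℚ) + ((p : ℚ) + 1) / p)

lemma risingProd_eq (m : ℕ) : risingProd p m =
    (∏ l ∈ Finset.range m, ((l : ℚ) + ((p : ℚ) + 1) / p)) * (m + ((p : ℚ) + 1) / p) :=
  Finset.prod_range_succ _ _

lemma frakM_eq (t : ℝ) : frakM p t = (p : ℚ) ^ (2 * ⌈t⌉₊ + 3) / ((p : ℚ) - 1) *
    risingProd p ⌈t⌉₊ ^ 2 - ((p : ℚ) - 1) * ∑ k ∈ Finset.range (⌈t⌉₊ + 1), ((k : ℚ) + 1) *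
      (p : ℚ) ^ k * ∏ l ∈ Finset.range k, ((l : ℚ) + ((p : ℚ) + 1) / p) := by
  rw [frakM, risingProd, Finset.prod_pow]

variable [Fact p.Prime]

lemma add_one_le_factor (k : ℕ) : (k : ℚ) + 1 ≤ k + ((p : ℚ) + 1) / p := by
  have hp0 : (0 : ℚ) < p := by exact_mod_cast (Fact.out : p.Prime).pos
  rw [add_le_add_iff_left, le_div_iff₀ hp0]
  linarith

lemma one_le_factor (k : ℕ) : (1 : ℚ) ≤ k + ((p : ℚ) + 1) / p :=
  le_trans (by simp) (add_one_le_factor k)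

lemma risingProd_mono : Monotone (risingProd p) := by
  refine monotone_nat_of_le_succ fun m => ?_
  rw [risingProd_eq (m + 1)]
  exact le_mul_of_one_le_right (Finset.prod_nonneg fun l _ => by positivity)
    (one_le_factor _)

lemma add_one_le_risingProd (m : ℕ) : (m : ℚ) + 1 ≤ risingProd p m := by
  rw [risingProd_eq]
  refine (add_one_le_factor m).trans (le_mul_of_one_le_left (by positivity) ?_)
  exact Finset.prod_induction _ (fun x : ℚ => 1 ≤ x) (fun _ _ => one_le_mul_of_one_le_of_one_le)
    le_rfl fun l _ => one_le_factor l

/-- The subtracted sum in `frakM` is at most `x = p ^ (m + 1) * risingProd p m`, the other term is at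
least `x ^ 2`. -/
lemma sq_sub_le_frakM (hp : 3 ≤ p) (t : ℝ) :
    ((p : ℚ) ^ (⌈t⌉₊ + 1) * risingProd p ⌈t⌉₊) ^ 2 - (p : ℚ) ^ (⌈t⌉₊ + 1) * risingProd p ⌈t⌉₊ ≤
      frakM p t := by
  have hp3 : (3 : ℚ) ≤ p := by exact_mod_cast hp
  rw [frakM_eq]
  set m := ⌈t⌉₊
  have hP : 0 < risingProd p m := lt_of_lt_of_le (by positivity) (add_one_le_risingProd m)
  refine sub_le_sub ?_ ?_
  · have h1 : (p : ℚ) ^ (2 * m + 2) ≤ (p : ℚ) ^ (2 * m + 3) / ((p : ℚ) - 1) := by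
      rw [le_div_iff₀ (by linarith), pow_succ _ (2 * m + 2)]
      exact mul_le_mul_of_nonneg_left (by linarith) (by positivity)
    calc ((p : ℚ) ^ (m + 1) * risingProd p m) ^ 2 = (p : ℚ) ^ (2 * m + 2) * risingProd p m ^ 2 := by
          ring
      _ ≤ _ := mul_le_mul_of_nonneg_right h1 (by positivity)
  · have h2 : ∀ k ∈ Finset.range (m + 1), ((k : ℚ) + 1) * (p : ℚ) ^ k *
        ∏ l ∈ Finset.range k, ((l : ℚ) + ((p : ℚ) + 1) / p) ≤ (p : ℚ) ^ k * risingProd p m := by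
      intro k hk
      have h3 : ((k : ℚ) + 1) * ∏ l ∈ Finset.range k, ((l : ℚ) + ((p : ℚ) + 1) / p) ≤
          risingProd p m := by
        refine le_trans ?_ (risingProd_mono (Nat.lt_succ_iff.1 (Finset.mem_range.1 hk)))
        rw [risingProd_eq, mul_comm]
        exact mul_le_mul_of_nonneg_left (add_one_le_factor k)
          (Finset.prod_nonneg fun l _ => by positivity)
      calc _ = (p : ℚ) ^ k *
            (((k : ℚ) + 1) * ∏ l ∈ Finset.range k, ((l : ℚ) + ((p : ℚ) + 1) / p)) := by ring
        _ ≤ _ := mul_le_mul_of_nonneg_left h3 (by positivity)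
    refine (mul_le_mul_of_nonneg_left (Finset.sum_le_sum h2) (by linarith)).trans ?_
    rw [← Finset.sum_mul, ← mul_assoc, mul_geom_sum]
    exact mul_le_mul_of_nonneg_right (by linarith) hP.le

lemma quadratic_le_frakM (hp : 3 ≤ p) (t : ℝ) :
    2 * ((⌈t⌉₊ : ℚ) + 1) ^ 2 ≤ frakM p t := by
  have hp3 : (3 : ℚ) ≤ p := by exact_mod_cast hp
  refine le_trans ?_ (sq_sub_le_frakM hp t)
  set m := ⌈t⌉₊
  have hP := add_one_le_risingProd (p := p) m
  have hpm : (3 : ℚ) ≤ (p : ℚ) ^ (m + 1) :=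
    hp3.trans (le_self_pow₀ (by linarith) m.succ_ne_zero)
  have hx : 3 * ((m : ℚ) + 1) ≤ (p : ℚ) ^ (m + 1) * risingProd p m :=
    mul_le_mul hpm hP (by positivity) (by positivity)
  nlinarith [(Nat.cast_nonneg m : (0 : ℚ) ≤ m)]

lemma frakM_pos (hp : 3 ≤ p) (t : ℝ) : 0 < frakM p t :=
  lt_of_lt_of_le (by positivity) (quadratic_le_frakM hp t)

lemma risingProd_mul_Gamma (m : ℕ) : (risingProd p m : ℝ) * Real.Gamma (1 + 1 / p) =
    Real.Gamma (m + 2 + 1 / p) := by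
  have hp0 : (0 : ℝ) < p := by exact_mod_cast (Fact.out : p.Prime).pos
  have h : ∀ k : ℕ, Real.Gamma (k + 2 + 1 / p) =
      (k + ((p : ℝ) + 1) / p) * Real.Gamma (k + 1 + 1 / p) := fun k => by
    have hk : (k : ℝ) + 1 + 1 / p ≠ 0 := by positivity
    rw [show (k : ℝ) + 2 + 1 / p = k + 1 + 1 / p + 1 by ring, Real.Gamma_add_one hk]
    congr 1
    field_simp
    ring
  induction m with
  | zero =>
    rw [h 0]
    simp [risingProd]
  | succ m ih =>
    rw [risingProd_eq (m + 1), ← risingProd, h (m + 1)]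
    push_cast
    rw [show (m : ℝ) + 1 + 1 + 1 / p = m + 2 + 1 / p by ring, ← ih]
    ring

/-- Discarding the subtracted sum leaves `p ^ (2 * m + 3) / (p - 1) * risingProd p m ^ 2` with
`m = ⌈t⌉ < t + 1`; the rising product is a quotient of values of `Γ`, which increases on
`[2, ∞)`. -/
lemma exists_frakM_le (hp : 3 ≤ p) : ∃ A : ℝ, 0 < A ∧ ∀ t : ℝ, 0 ≤ t →
    (frakM p t : ℝ) ≤ A * ((p : ℝ) ^ (2 * t) * Real.Gamma (t + (3 + 1 / (p : ℝ))) ^ 2) := by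
  have hp3 : (3 : ℝ) ≤ p := by exact_mod_cast hp
  have hp3q : (3 : ℚ) ≤ p := by exact_mod_cast hp
  have hp0 : (0 : ℝ) < 1 / p := by positivity
  have hG : 0 < Real.Gamma (1 + 1 / p) := Real.Gamma_pos_of_pos (by positivity)
  have hp1 : (0 : ℝ) < p - 1 := by linarith
  refine ⟨(p : ℝ) ^ 5 / (p - 1) / Real.Gamma (1 + 1 / p) ^ 2, by positivity, fun t ht => ?_⟩
  have hM : frakM p t ≤ (p : ℚ) ^ (2 * ⌈t⌉₊ + 3) / ((p : ℚ) - 1) * risingProd p ⌈t⌉₊ ^ 2 := by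
    rw [frakM_eq]
    refine sub_le_self _ (mul_nonneg (by linarith) (Finset.sum_nonneg fun k _ => ?_))
    exact mul_nonneg (by positivity) (Finset.prod_nonneg fun l _ => by positivity)
  have hm : (⌈t⌉₊ : ℝ) < t + 1 := Nat.ceil_lt_add_one ht
  set m := ⌈t⌉₊
  have hM' : (frakM p t : ℝ) ≤ (p : ℝ) ^ (2 * m + 3) / (p - 1) * (risingProd p m : ℝ) ^ 2 := by
    exact_mod_cast hM
  have hpow : (p : ℝ) ^ (2 * m + 3) ≤ (p : ℝ) ^ 5 * (p : ℝ) ^ (2 * t) := by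
    rw [← Real.rpow_natCast, ← Real.rpow_natCast, ← Real.rpow_add (by linarith)]
    refine Real.rpow_le_rpow_of_exponent_le (by linarith) ?_
    push_cast
    linarith
  have hGam : (risingProd p m : ℝ) * Real.Gamma (1 + 1 / p) ≤
      Real.Gamma (t + (3 + 1 / (p : ℝ))) := by
    rw [risingProd_mul_Gamma]
    refine Real.Gamma_strictMonoOn_Ici.monotoneOn ?_ ?_ (by linarith)
    · rw [Set.mem_Ici]; have : (0 : ℝ) ≤ m := m.cast_nonneg; linarith
    · rw [Set.mem_Ici]; linarith
  have hP0 : (0 : ℝ) ≤ risingProd p m := by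
    exact_mod_cast le_trans (by positivity) (add_one_le_risingProd (p := p) m)
  have hsq := pow_le_pow_left₀ (by positivity) hGam 2
  calc (frakM p t : ℝ) ≤ (p : ℝ) ^ (2 * m + 3) / (p - 1) * (risingProd p m : ℝ) ^ 2 := hM'
    _ = (p : ℝ) ^ (2 * m + 3) * (risingProd p m * Real.Gamma (1 + 1 / p)) ^ 2 *
          (1 / (p - 1) / Real.Gamma (1 + 1 / p) ^ 2) := by field_simp
    _ ≤ ((p : ℝ) ^ 5 * (p : ℝ) ^ (2 * t)) * Real.Gamma (t + (3 + 1 / (p : ℝ))) ^ 2 *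
          (1 / (p - 1) / Real.Gamma (1 + 1 / p) ^ 2) := by gcongr
    _ = _ := by ring

end Numeric

/-! ### The leading monomial and the bound for the valuation -/

section

variable {p : ℕ}

/-- The weight of `X ^ i Y ^ j`, that is, the valuation of `u ^ i * η ^ j`. -/
def weight (p : ℕ) (i j : ℕ) : ℝ := i + j * ((p : ℝ) / (p - 1))

lemma le_weight (hp : 3 ≤ p) (i j : ℕ) : (i : ℝ) ≤ weight p i j ∧ (j : ℝ) ≤ weight p i j := by
  have hp3 : (3 : ℝ) ≤ p := by exact_mod_cast hp
  have h1 : (1 : ℝ) ≤ (p : ℝ) / (p - 1) := by rw [le_div_iff₀ (by linarith)]; linarith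
  have h2 : (j : ℝ) ≤ j * ((p : ℝ) / (p - 1)) := le_mul_of_one_le_right (Nat.cast_nonneg j) h1
  have h3 : (0 : ℝ) ≤ i := Nat.cast_nonneg i
  have h4 : (0 : ℝ) ≤ j := Nat.cast_nonneg j
  constructor <;> unfold weight <;> linarith

variable [Fact p.Prime]

/-- Among the monomials of least weight in `F`, the one of highest degree in `X`. -/
lemma exists_leading_monomial (hp : 3 ≤ p) {F : MvPowerSeries (Fin 2) (ZMod p)} (hF : F ≠ 0) :
    ∃ n j₀, coeffXY F n j₀ ≠ 0 ∧ ∀ i j, coeffXY F i j ≠ 0 →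
      weight p n j₀ ≤ weight p i j ∧ (weight p i j = weight p n j₀ → i ≤ n) := by
  obtain ⟨i₁, j₁, h₁⟩ : ∃ i j, coeffXY F i j ≠ 0 := by
    by_contra! h
    refine hF (MvPowerSeries.ext fun m => ?_)
    have hm : m = Finsupp.single 0 (m 0) + Finsupp.single 1 (m 1) := by
      ext k; fin_cases k <;> simp
    rw [hm]
    exact h (m 0) (m 1)
  classical
  let B := ⌈weight p i₁ j₁⌉₊ + 1
  have hB : ∀ i j, weight p i j ≤ weight p i₁ j₁ → i < B ∧ j < B := fun i j h => by
    have h2 := Nat.le_ceil (weight p i₁ j₁)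
    have h3 := le_weight hp i j
    constructor <;> refine Nat.lt_succ_of_le (Nat.cast_le (α := ℝ).1 ?_) <;> linarith [h3.1, h3.2]
  let s : Finset (ℕ × ℕ) :=
    (Finset.range B ×ˢ Finset.range B).filter fun x => coeffXY F x.1 x.2 ≠ 0
  have hs : ∀ i j, weight p i j ≤ weight p i₁ j₁ → coeffXY F i j ≠ 0 → (i, j) ∈ s :=
    fun i j h h' => by simp [s, hB i j h, h']
  obtain ⟨⟨a, b⟩, hab, hmin⟩ := s.exists_min_image (fun x => weight p x.1 x.2)
    ⟨(i₁, j₁), hs _ _ le_rfl h₁⟩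
  obtain ⟨⟨n, j₀⟩, hnj, hmax⟩ :=
    (s.filter fun x => weight p x.1 x.2 = weight p a b).exists_max_image
      (fun x => x.1) ⟨(a, b), by simp [hab]⟩
  have hnj' := Finset.mem_filter.1 hnj
  have hle : ∀ i j, coeffXY F i j ≠ 0 → weight p n j₀ ≤ weight p i j := fun i j h => by
    rw [hnj'.2]
    rcases le_total (weight p i j) (weight p i₁ j₁) with h1 | h1
    · exact hmin _ (hs i j h1 h)
    · exact (hmin _ (hs _ _ le_rfl h₁)).trans h1
  refine ⟨n, j₀, (Finset.mem_filter.1 hnj'.1).2, fun i j h => ⟨hle i j h, fun h2 => ?_⟩⟩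
  refine hmax (i, j) (Finset.mem_filter.2 ⟨hs i j ?_ h, h2.trans hnj'.2⟩)
  rw [h2]
  exact hle _ _ h₁

lemma absFlat_castHom {c : ZMod p} (hc : c ≠ 0) :
    absFlat (ZMod.castHom (dvd_refl p) (OCpFlat p) c) = 1 := by
  have h := congrArg (fun c => absFlat (ZMod.castHom (dvd_refl p) (OCpFlat p) c))
    (ZMod.pow_card_sub_one_eq_one hc)
  simp only [map_pow, map_one] at h
  have := (Fact.out : p.Prime).two_le
  exact (pow_eq_one_iff_of_nonneg zero_le (by omega)).1 h

lemma vFlat_eq_of_absFlat_eq {x : OCpFlat p} {c : ℝ} (h : (absFlat x : ℝ) = (p : ℝ) ^ (-c)) :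
    vFlat x = (c : EReal) := by
  have hp1 : (1 : ℝ) < p := by exact_mod_cast (Fact.out : p.Prime).one_lt
  have h0 : x ≠ 0 := by
    rintro rfl
    rw [map_zero, NNReal.coe_zero] at h
    exact (Real.rpow_pos_of_pos (by linarith) _).ne h
  rw [vFlat, if_neg h0, h, Real.logb_rpow (by linarith) hp1.ne', neg_neg]

section Term

variable {α β : OCpFlat p} {F : MvPowerSeries (Fin 2) (ZMod p)}

lemma absFlat_term (hα : (absFlat α : ℝ) = (p : ℝ) ^ (-1 : ℝ))
    (hβ : (absFlat β : ℝ) = (p : ℝ) ^ (-((p : ℝ) / (p - 1)))) {i j : ℕ} (h : coeffXY F i j ≠ 0) :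
    (absFlat (ZMod.castHom (dvd_refl p) (OCpFlat p) (coeffXY F i j) * α ^ i * β ^ j) : ℝ) =
      (p : ℝ) ^ (-weight p i j) := by
  have hp0 : (0 : ℝ) < p := by exact_mod_cast (Fact.out : p.Prime).pos
  rw [map_mul, map_mul, map_pow, map_pow, absFlat_castHom h, one_mul]
  push_cast
  rw [hα, hβ, ← Real.rpow_natCast, ← Real.rpow_natCast, ← Real.rpow_mul hp0.le,
    ← Real.rpow_mul hp0.le, ← Real.rpow_add hp0]
  congr 1
  unfold weight
  ring

lemma vMono_eq (hα : (absFlat α : ℝ) = (p : ℝ) ^ (-1 : ℝ))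
    (hβ : (absFlat β : ℝ) = (p : ℝ) ^ (-((p : ℝ) / (p - 1)))) {n j₀ : ℕ}
    (hn : coeffXY F n j₀ ≠ 0) (h : ∀ i j, coeffXY F i j ≠ 0 → weight p n j₀ ≤ weight p i j) :
    vMono α β F = ((weight p n j₀ : ℝ) : EReal) := by
  have e : ∀ i j : ℕ, (i : EReal) * vFlat α + (j : EReal) * vFlat β =
      ((weight p i j : ℝ) : EReal) := fun i j => by
    rw [vFlat_eq_of_absFlat_eq hα, vFlat_eq_of_absFlat_eq hβ, weight]
    push_cast
    rw [mul_one]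
  simp only [vMono, e]
  refine le_antisymm (iInf_le_of_le n (iInf_le_of_le j₀ (iInf_le _ hn))) ?_
  exact le_iInf fun i => le_iInf fun j => le_iInf fun hij => EReal.coe_le_coe_iff.2 (h i j hij)

lemma le_vFlat_of_isValueAt (hα : (absFlat α : ℝ) = (p : ℝ) ^ (-1 : ℝ))
    (hβ : (absFlat β : ℝ) = (p : ℝ) ^ (-((p : ℝ) / (p - 1)))) {f : OCpFlat p}
    (hf : IsValueAt α β F f) {w : ℝ} (h : ∀ i j, coeffXY F i j ≠ 0 → w ≤ weight p i j) :
    (w : EReal) ≤ vFlat f := by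
  have hp1 : (1 : ℝ) ≤ p := by exact_mod_cast (Fact.out : p.Prime).one_le
  obtain ⟨N, hN⟩ := (hf w).exists
  let δ : ℝ≥0 := ⟨(p : ℝ) ^ (-w), by positivity⟩
  have hS : absFlat (partialSum α β F N) ≤ δ := by
    refine absFlat.map_sum_le fun i _ => absFlat.map_sum_le fun j _ => ?_
    by_cases hc : coeffXY F i j = 0
    · rw [hc]; simp
    · rw [← NNReal.coe_le_coe, absFlat_term hα hβ hc]
      exact Real.rpow_le_rpow_of_exponent_le hp1 (neg_le_neg (h i j hc))
  rw [le_vFlat_iff] at hN ⊢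
  have h2 := absFlat.map_sub (partialSum α β F N) (partialSum α β F N - f)
  rw [sub_sub_cancel] at h2
  exact (h2.trans (max_le hS hN) : absFlat f ≤ δ)

end Term

/-- The leading monomial `u ^ n * η ^ j₀` dominates the sum obtained by applying
`∏_{k < n} (τ - ε ^ k)`: lower powers of `u` are killed, and the factor of a higher power of `u` is
a multiple of the factor of `u ^ n`. -/
lemma absFlat_sum_qFactor {u ε : OCpFlat p} (hu : (absFlat u : ℝ) = (p : ℝ) ^ (-1 : ℝ))
    (hη : (absFlat (ε - 1) : ℝ) = (p : ℝ) ^ (-((p : ℝ) / (p - 1))))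
    (hη1 : absFlat (ε - 1) < 1)
    {F : MvPowerSeries (Fin 2) (ZMod p)} {n j₀ N : ℕ} (hnN : n ≤ N) (hjN : j₀ ≤ N)
    (hn : coeffXY F n j₀ ≠ 0) (h : ∀ i j, coeffXY F i j ≠ 0 →
      weight p n j₀ ≤ weight p i j ∧ (weight p i j = weight p n j₀ → i ≤ n)) :
    (absFlat (∑ i ∈ Finset.range (N + 1), (∑ j ∈ Finset.range (N + 1),
      ZMod.castHom (dvd_refl p) (OCpFlat p) (coeffXY F i j) * u ^ i * (ε - 1) ^ j) *
        qFactor ε i n) : ℝ) = (p : ℝ) ^ (-weight p n j₀) * absFlat (qFactor ε n n) := by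
  classical
  have hp2 : (2 : ℝ) ≤ p := by exact_mod_cast (Fact.out : p.Prime).two_le
  have hp1 : (1 : ℝ) < p := by linarith
  have hc0 : (0 : ℝ) < (p : ℝ) / (p - 1) := div_pos (by linarith) (by linarith)
  let T : ℕ × ℕ → OCpFlat p := fun x =>
    ZMod.castHom (dvd_refl p) (OCpFlat p) (coeffXY F x.1 x.2) * u ^ x.1 * (ε - 1) ^ x.2 *
      qFactor ε x.1 n
  have hsum : ∑ i ∈ Finset.range (N + 1), (∑ j ∈ Finset.range (N + 1),
      ZMod.castHom (dvd_refl p) (OCpFlat p) (coeffXY F i j) * u ^ i * (ε - 1) ^ j) *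
        qFactor ε i n = ∑ x ∈ Finset.range (N + 1) ×ˢ Finset.range (N + 1), T x := by
    rw [Finset.sum_product]
    exact Finset.sum_congr rfl fun i _ => Finset.sum_mul _ _ _
  have hη0 : 0 < absFlat (ε - 1) := by
    rw [← NNReal.coe_pos, hη]; exact Real.rpow_pos_of_pos (by linarith) _
  have hq0 : 0 < absFlat (qFactor ε n n) :=
    (pow_pos hη0 _).trans_le (le_map_qFactor_self absFlat hη1 n)
  have hlead : (absFlat (T (n, j₀)) : ℝ) =
      (p : ℝ) ^ (-weight p n j₀) * absFlat (qFactor ε n n) := by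
    rw [map_mul, NNReal.coe_mul, absFlat_term hu hη hn]
  have hlead0 : absFlat (T (n, j₀)) ≠ 0 := by
    rw [← NNReal.coe_ne_zero, hlead]
    have : (0 : ℝ) < (p : ℝ) ^ (-weight p n j₀) := Real.rpow_pos_of_pos (by linarith) _
    have : (0 : ℝ) < absFlat (qFactor ε n n) := hq0
    positivity
  rw [hsum, ← Finset.add_sum_erase _ T (a := (n, j₀)) (by simp; omega),
    absFlat.map_add_eq_of_lt_left, hlead]
  refine absFlat.map_sum_lt hlead0 fun x hx => ?_
  obtain ⟨i, j⟩ := x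
  have hne : (i, j) ≠ (n, j₀) := (Finset.mem_erase.1 hx).1
  replace hlead0 := pos_iff_ne_zero.2 hlead0
  by_cases hc : coeffXY F i j = 0
  · simpa [T, hc] using hlead0
  rcases lt_or_ge i n with hi | hi
  · simpa [T, qFactor_of_lt ε hi] using hlead0
  have hlt : weight p n j₀ < weight p i j := by
    refine lt_of_le_of_ne (h i j hc).1 fun heq => hne ?_
    -- on the same power of `u`, monomials of equal weight coincide
    have hin : i = n := le_antisymm ((h i j hc).2 heq.symm) hi
    subst hin
    have : (j₀ : ℝ) = j := mul_right_cancel₀ hc0.ne' (add_left_cancel heq)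
    rw [Nat.cast_inj.1 this]
  obtain ⟨g, hg⟩ := qFactor_self_dvd ε i n
  rw [← NNReal.coe_lt_coe, hlead]
  simp only [T]
  rw [map_mul, NNReal.coe_mul, absFlat_term hu hη hc, hg, map_mul]
  have hg1 : absFlat (qFactor ε n n) * absFlat g ≤ absFlat (qFactor ε n n) :=
    mul_le_of_le_one_right' (absFlat_le_one g)
  refine (mul_le_mul_of_nonneg_left (NNReal.coe_le_coe.2 hg1) (by positivity)).trans_lt ?_
  exact mul_lt_mul_of_pos_right (Real.rpow_lt_rpow_of_exponent_lt hp1 (neg_lt_neg hlt)) hq0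

/-- The quantitative form of the independence of `u` and `η`: the excess of `v^♭(f)` over
`v_mono(f)` is at most quadratic in `v_mono(f)`. -/
lemma le_weight_add (hp : 3 ≤ p) {u ε : OCpFlat p} (hu : (absFlat u : ℝ) = (p : ℝ) ^ (-1 : ℝ))
    (hη : (absFlat (ε - 1) : ℝ) = (p : ℝ) ^ (-((p : ℝ) / (p - 1))))
    {F : MvPowerSeries (Fin 2) (ZMod p)} {n j₀ N : ℕ} (hnN : n ≤ N) (hjN : j₀ ≤ N)
    (hn : coeffXY F n j₀ ≠ 0) (h : ∀ i j, coeffXY F i j ≠ 0 →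
      weight p n j₀ ≤ weight p i j ∧ (weight p i j = weight p n j₀ → i ≤ n))
    {V : ℝ} (hV : ∀ a, (absFlat (partialSum (u * ε ^ a) (ε - 1) F N) : ℝ) ≤ (p : ℝ) ^ (-V)) :
    V ≤ weight p n j₀ + (p : ℝ) / (p - 1) * (n * (n + 1) / 2) := by
  have hp3 : (3 : ℝ) ≤ p := by exact_mod_cast hp
  have hp1 : (1 : ℝ) < p := by linarith
  have hp0 : (0 : ℝ) < p := by linarith
  have hc0 : (0 : ℝ) < (p : ℝ) / (p - 1) := div_pos (by linarith) (by linarith)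
  have hη1 : absFlat (ε - 1) < 1 := by
    rw [← NNReal.coe_lt_coe, hη]
    exact Real.rpow_lt_one_of_one_lt_of_neg hp1 (by linarith)
  let δ : ℝ≥0 := ⟨(p : ℝ) ^ (-V), by positivity⟩
  have hterm : ∀ a i, (∑ j ∈ Finset.range (N + 1),
      ZMod.castHom (dvd_refl p) (OCpFlat p) (coeffXY F i j) * (u * ε ^ a) ^ i * (ε - 1) ^ j) =
      (∑ j ∈ Finset.range (N + 1),
        ZMod.castHom (dvd_refl p) (OCpFlat p) (coeffXY F i j) * (ε - 1) ^ j) *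
          (u * ε ^ a) ^ i := fun a i => by
    rw [Finset.sum_mul]
    exact Finset.sum_congr rfl fun j _ => by ring
  have hop := map_sum_qFactor_le absFlat (absFlat_le_one ε) (Finset.range (N + 1))
    (fun i => ∑ j ∈ Finset.range (N + 1),
      ZMod.castHom (dvd_refl p) (OCpFlat p) (coeffXY F i j) * (ε - 1) ^ j) u (δ := δ)
    (fun a => by
      have h1 : absFlat (partialSum (u * ε ^ a) (ε - 1) F N) ≤ δ := hV a
      simpa only [partialSum, hterm] using h1) n 0
  simp only [← hterm] at hop
  simp only [pow_zero, mul_one] at hop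
  have hT := absFlat_sum_qFactor hu hη hη1 hnN hjN hn h
  have h2 : (p : ℝ) ^ (-weight p n j₀) * absFlat (qFactor ε n n) ≤ (p : ℝ) ^ (-V) := by
    rw [← hT]; exact hop
  have h3 : ((absFlat (ε - 1) ^ (n * (n + 1) / 2) : ℝ≥0) : ℝ) ≤ absFlat (qFactor ε n n) :=
    NNReal.coe_le_coe.2 (le_map_qFactor_self absFlat hη1 n)
  have hdiv : ((n * (n + 1) / 2 : ℕ) : ℝ) = n * (n + 1) / 2 := by
    rw [Nat.cast_div (Nat.even_mul_succ_self n).two_dvd two_ne_zero]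
    push_cast
    rfl
  rw [NNReal.coe_pow, hη, ← Real.rpow_natCast, ← Real.rpow_mul hp0.le, hdiv] at h3
  have h4 := (mul_le_mul_of_nonneg_left h3
    (Real.rpow_nonneg hp0.le (-weight p n j₀))).trans h2
  rw [← Real.rpow_add hp0, Real.rpow_le_rpow_left_iff hp1] at h4
  linarith

lemma weight_add_lt_frakM (hp : 3 ≤ p) (n j₀ : ℕ) :
    weight p n j₀ + (p : ℝ) / (p - 1) * (n * (n + 1) / 2) < frakM p (weight p n j₀) := by
  have hp3 : (3 : ℝ) ≤ p := by exact_mod_cast hp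
  set w := weight p n j₀
  have h1 : (2 * ((⌈w⌉₊ : ℝ) + 1) ^ 2) ≤ frakM p w := by
    exact_mod_cast quadratic_le_frakM hp w
  refine lt_of_lt_of_le ?_ h1
  have h2 : w ≤ ⌈w⌉₊ := Nat.le_ceil w
  have h3 : (n : ℝ) ≤ ⌈w⌉₊ := (le_weight hp n j₀).1.trans h2
  have h4 : (p : ℝ) / (p - 1) ≤ 2 := by rw [div_le_iff₀ (by linarith)]; linarith
  have h5 : (0 : ℝ) ≤ n := Nat.cast_nonneg n
  have h6 : (p : ℝ) / (p - 1) * (n * (n + 1) / 2) ≤ 2 * (n * (n + 1) / 2) :=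
    mul_le_mul_of_nonneg_right h4 (by positivity)
  nlinarith

end

end FalseTate

end

open FalseTate in
theorem theoremD (p : ℕ) [Fact p.Prime] (hp : 3 ≤ p) :
    (∀ t : ℝ, 0 ≤ t → 0 < frakM p t) ∧
    (∃ A : ℝ, 0 < A ∧ ∀ t : ℝ, 0 ≤ t →
      (frakM p t : ℝ) ≤ A * ((p : ℝ) ^ (2 * t) * Real.Gamma (t + (3 + 1 / (p : ℝ))) ^ 2)) ∧
    ∀ (π : ℤ_[p]) (_ : Irreducible π)
      (ϖ : ℕ → 𝓞_ℂ_[p]) (_ : (ϖ 0 : ℂ_[p]) = algebraMap ℚ_[p] ℂ_[p] (π : ℚ_[p]))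
      (hϖ : ∀ n, ϖ (n + 1) ^ p = ϖ n)
      (ζ : ℕ → 𝓞_ℂ_[p]) (_ : ∀ n, IsPrimitiveRoot (ζ n) (p ^ n))
      (hζ : ∀ n, ζ (n + 1) ^ p = ζ n)
      (u η : OCpFlat p) (_ : u = ofRoots ϖ hϖ) (_ : η = ofRoots ζ hζ - 1)
      (F : MvPowerSeries (Fin 2) (ZMod p)) (_ : F ≠ 0)
      (f : OCpFlat p) (_ : f = evalXY u η F)
      (_ : ((frakM p 0 : ℝ) : EReal) ≤ vFlat f),
      ∃ m : ℝ, vMono u η F = (m : EReal) ∧ (m : EReal) ≤ vFlat f ∧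
        vFlat f < ((frakM p m : ℝ) : EReal) := by
  refine ⟨fun t _ => frakM_pos hp t, exists_frakM_le hp, ?_⟩
  rintro π hπ ϖ hϖ0 hϖ ζ hprim hζ u η rfl rfl F hF f rfl -
  have hp3 : (3 : ℝ) ≤ p := by exact_mod_cast hp
  have hp0 : (0 : ℝ) < p := by linarith
  have hu : (absFlat (ofRoots ϖ hϖ) : ℝ) = (p : ℝ) ^ (-1 : ℝ) := by
    rw [absFlat_ofRoots_uniformizer hπ hϖ0 hϖ, Real.rpow_neg_one]
  have hη : (absFlat (ofRoots ζ hζ - 1) : ℝ) = (p : ℝ) ^ (-((p : ℝ) / (p - 1))) := by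
    have h := absFlat_ofRoots_sub_one hp hprim hζ
    refine (pow_left_inj₀ (NNReal.coe_nonneg _) (by positivity)
      (show p - 1 ≠ 0 by omega)).1 (h.trans ?_)
    rw [← Real.rpow_natCast _ (p - 1), ← Real.rpow_mul hp0.le, Nat.cast_sub (by omega),
      Nat.cast_one, neg_mul, div_mul_cancel₀ _ (by linarith), Real.rpow_neg hp0.le,
      Real.rpow_natCast, inv_pow]
  have hζ0 : ζ 0 = 1 := by simpa using hprim 0
  have hval := isValueAt_evalXY (coeff_zero_ofRoots_uniformizer hπ hϖ0 hϖ)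
    (coeff_zero_ofRoots_one hζ0 hζ) F
  obtain ⟨n, j₀, hn, hlead⟩ := exists_leading_monomial hp hF
  refine ⟨weight p n j₀, vMono_eq hu hη hn fun i j h => (hlead i j h).1,
    le_vFlat_of_isValueAt hu hη hval fun i j h => (hlead i j h).1, ?_⟩
  by_contra! hcon
  set V : ℝ := ((frakM p (weight p n j₀) : ℚ) : ℝ)
  obtain ⟨N, hN, hnN, hjN⟩ := ((hval V).and
    ((Filter.eventually_ge_atTop n).and (Filter.eventually_ge_atTop j₀))).exists
  have hS : (absFlat (partialSum (ofRoots ϖ hϖ) (ofRoots ζ hζ - 1) F N) : ℝ) ≤ (p : ℝ) ^ (-V) := by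
    rw [le_vFlat_iff] at hN hcon
    have h2 := absFlat.map_add (partialSum (ofRoots ϖ hϖ) (ofRoots ζ hζ - 1) F N -
      evalXY (ofRoots ϖ hϖ) (ofRoots ζ hζ - 1) F) (evalXY (ofRoots ϖ hϖ) (ofRoots ζ hζ - 1) F)
    rw [sub_add_cancel] at h2
    exact (NNReal.coe_le_coe.2 h2).trans (by rw [NNReal.coe_max]; exact max_le hN hcon)
  have hle := le_weight_add hp hu hη hnN hjN hn hlead (V := V) fun a => by
    rw [absFlat_partialSum_mul_pow hp hπ hϖ0 hϖ hprim hζ]; exact hS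
  exact (weight_add_lt_frakM hp n j₀).not_ge hle
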